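/- **Setting.** Let $D,m,N,q\in\mathbb{N}=\{1,2,\dots\}$ with $m<N$, let $Z\subseteq\mathbb{R}^D$ be compact, let $\mathscr{R}_1,\dots,\mathscr{R}_N\in Z$, and let $\varepsilon>0$, $\widetilde\varepsilon>0$, $C>0$, $\lambda\ge 0$. Put $\Omega_{\mathrm{loc}}:=Z^m\subseteq\mathbb{R}^{Dm}$ and $A:=[-C,C]^D$; $\|\cdot\|$ denotes Euclidean norms and $\mathcal{M}_1(\cdot)$ Borel probability measures. For $x=(x_1,\dots,x_m)\in\Omega_{\mathrm{loc}}$ let $\pi(x):=(x_2,\dots,x_m)$ and, for $s=m,\dots,N-1$, $$\operatorname{dist}_s(x):=\|(\mathscr{R}_{s-m+1},\dots,\mathscr{R}_s)-x\|,\qquad \pi_s(x):=\frac{(\operatorname{dist}_s(x)+\widetilde\varepsilon)^{-1}}{\sum_{\ell=m}^{N-1}(\operatorname{dist}_\ell(x)+\widetilde\varepsilon)^{-1}},\qquad \widehat{\mathbb{P}}(x):=\sum_{s=m}^{N-1}\pi_s(x)\,\delta_{\mathscr{R}_{s+1}}\in\mathcal{M}_1(Z).$$ With $W_q(\mu,\nu):=\big(\inf_\gamma\int\|y-z\|^q\,\gamma(dy,dz)\big)^{1/q}$,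 the infimum being over all joint distributions $\gamma$ of $\mu,\nu\in\mathcal{M}_1(Z)$, define $$\mathcal{P}(x,a):=\mathcal{P}(x):=\big\{\delta_{\pi(x)}\otimes\mathbb{P}\ \big|\ \mathbb{P}\in\mathcal{M}_1(Z),\ W_q(\mathbb{P},\widehat{\mathbb{P}}(x))\le\varepsilon\big\}\subseteq\mathcal{M}_1(\Omega_{\mathrm{loc}}),\qquad (x,a)\in\Omega_{\mathrm{loc}}\times A.$$ For $x_0,x_1\in\Omega_{\mathrm{loc}}$ and $a\in A$ let $$r(x_0,a,x_1):=\sum_{i=1}^D a^i z^i-\lambda\,a^T\Sigma a,$$ where $z\in Z$ is the last (that is, $m$-th) component of $x_1$ and where $\Sigma$ is either the sample covariance $\frac1{N-1}\sum_{s=1}^N(\mathscr{R}_s-\mathrm{ER})(\mathscr{R}_s-\mathrm{ER})^T$ with $\mathrm{ER}:=\frac1N\sum_{s=1}^N\mathscr{R}_s$, or any other covariance matrix (a positive semidefinite matrix in $\mathbb{R}^{D\times D}$). **Assumptions.** Let $p\in\{0,1\}$. Let $\tau_p$ be the topology on $\mathcal{M}_1(\Omega_{\mathrm{loc}})$ in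 which $\mu_n\to\mu$ means $\int g\,d\mu_n\to\int g\,d\mu$ for all continuous $g:\Omega_{\mathrm{loc}}\to\mathbb{R}$ with $\sup_x|g(x)|/(1+\|x\|^p)<\infty$ (for $p=0$: weak convergence; here $\|x\|^0=1$). *Assumption 2.2* (for $\mathcal{P}$, with constant $C_P$): (i) $(x,a)\twoheadrightarrow\mathcal{P}(x,a)$ from $\Omega_{\mathrm{loc}}\times A$ to $(\mathcal{M}_1(\Omega_{\mathrm{loc}}),\tau_p)$ is nonempty, compact-valued and continuous, i.e. both upper and lower hemicontinuous; (ii) $C_P\ge1$ and $\int(1+\|y\|^p)\,\mathbb{P}(dy)\le C_P(1+\|x\|^p)$ for all $(x,a)$ and all $\mathbb{P}\in\mathcal{P}(x,a)$. *Assumption 2.4* (for $r$, a discount factor $\alpha<1$, and the same $p$ and $C_P$): (i) $r$ is continuous on $\Omega_{\mathrm{loc}}\times A\times\Omega_{\mathrm{loc}}$; (ii) there are $L>0$ and functions $\rho_0,\rho_A:[0,\infty]\to[0,\infty]$ with $\lim_{u\to0}\rho_\bullet(u)=0=\rho_\bullet(0)$ such that $|r(x_0,a,x_1)-r(x_0',a',x_1)|\le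 L(1+\|x_1\|^p)\big(\rho_0(\|x_0-x_0'\|)+\rho_A(\|a-a'\|)\big)$ for all $x_0,x_0',x_1\in\Omega_{\mathrm{loc}}$ and $a,a'\in A$; (iii) there is $C_r\ge1$ with $|r(x_0,a,x_1)|\le C_r(1+\|x_0\|^p+\|x_1\|^p)$ for all $x_0,x_1\in\Omega_{\mathrm{loc}}$ and $a\in A$; (iv) $0<\alpha<1/C_P$. **Proposition 4.1.** Let $p=0$. There is a constant $C_P$ such that $\mathcal{P}$ satisfies Assumption 2.2 with $C_P$ and such that, for every discount factor $\alpha\in(0,1)$, the reward function $r$ satisfies Assumption 2.4 with $C_P$ and $\alpha$. -/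

import Mathlib

open MeasureTheory Filter Topology
open scoped ENNReal

noncomputable section

namespace RobustMDP

section Setting

variable {ι κ : Type*} [Fintype ι] [Fintype κ]

/-- `C_p(X, ℝ)`: continuous real functions on `X ⊆ ℝ^ι` of polynomial growth at most of degree
`p`, i.e. `sup_{x ∈ X} |g x| / (1 + ‖x‖ ^ p) < ∞` (Euclidean norm). -/
def polyGrowth (p : ℕ) (X : Set (EuclideanSpace ℝ ι)) : Set (X → ℝ) :=
  {g | Continuous g ∧
    BddAbove (Set.range fun x : X => |g x| / (1 + ‖(x : EuclideanSpace ℝ ι)‖ ^ p))}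

/-- The topology `τ_p` on the probability measures on `X`: the coarsest topology for which
`μ ↦ ∫ g dμ` is continuous for every `g ∈ C_p(X, ℝ)`, so that `μ_n → μ` iff
`∫ g dμ_n → ∫ g dμ` for all `g ∈ C_p(X, ℝ)`. For `p = 0` the test functions are exactly the
bounded continuous functions (all integrable), and `τ_0` is the topology of weak convergence. -/
@[reducible]
def tau (p : ℕ) (X : Set (EuclideanSpace ℝ ι)) : TopologicalSpace (ProbabilityMeasure X) :=
  ⨅ g ∈ polyGrowth p X,
    TopologicalSpace.induced (fun μ : ProbabilityMeasure X => ∫ x, g x ∂(μ : Measure X))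
      inferInstance

/-- The standing assumption on the set of measures `(x, a) ↠ P (x, a)` on the state space `Ω`
with action set `A`, with growth constant `C_P`: the correspondence is nonempty, compact-valued
and continuous (upper and lower hemicontinuous) into `(M_1(Ω), τ_p)`, and
`∫ (1 + ‖y‖ ^ p) dℙ ≤ C_P (1 + ‖x‖ ^ p)` for every `ℙ ∈ P (x, a)`. -/
structure MeasureAssumption (p : ℕ) {Ω : Set (EuclideanSpace ℝ ι)}
    {A : Set (EuclideanSpace ℝ κ)} (P : Ω × A → Set (ProbabilityMeasure Ω)) (C_P : ℝ) :
    Prop where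
  exponent : p = 0 ∨ p = 1
  nonempty : ∀ xa, (P xa).Nonempty
  compact : ∀ xa, @IsCompact (ProbabilityMeasure Ω) (tau p Ω) (P xa)
  upperHemicontinuous : @UpperHemicontinuous (Ω × A) (ProbabilityMeasure Ω) _ (tau p Ω) P
  lowerHemicontinuous : @LowerHemicontinuous (Ω × A) (ProbabilityMeasure Ω) _ (tau p Ω) P
  one_le_const : 1 ≤ C_P
  growth : ∀ (x : Ω) (a : A), ∀ ℙ ∈ P (x, a),
    ∫⁻ y, ENNReal.ofReal (1 + ‖(y : EuclideanSpace ℝ ι)‖ ^ p) ∂(ℙ : Measure Ω) ≤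
      ENNReal.ofReal (C_P * (1 + ‖(x : EuclideanSpace ℝ ι)‖ ^ p))

/-- A modulus of continuity: `ρ : [0, ∞] → [0, ∞]` with `lim_{x → 0} ρ x = 0 = ρ 0`. -/
def IsModulus (ρ : ℝ≥0∞ → ℝ≥0∞) : Prop :=
  ρ 0 = 0 ∧ Tendsto ρ (𝓝 0) (𝓝 0)

/-- The standing assumption on the reward function `r` and the discount factor `α`, where
`p` and `C_P` are those of the assumption on the set of measures. -/
structure RewardAssumption (p : ℕ) {Ω : Set (EuclideanSpace ℝ ι)}
    {A : Set (EuclideanSpace ℝ κ)} (r : Ω → A → Ω → ℝ) (C_P α : ℝ) : Prop where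
  continuous : Continuous fun t : Ω × A × Ω => r t.1 t.2.1 t.2.2
  modulus : ∃ L : ℝ, 0 < L ∧ ∃ ρ₀ ρA : ℝ≥0∞ → ℝ≥0∞, IsModulus ρ₀ ∧ IsModulus ρA ∧
    ∀ (x₀ x₀' x₁ : Ω) (a a' : A),
      ENNReal.ofReal |r x₀ a x₁ - r x₀' a' x₁| ≤
        ENNReal.ofReal (L * (1 + ‖(x₁ : EuclideanSpace ℝ ι)‖ ^ p)) *
          (ρ₀ (ENNReal.ofReal ‖(x₀ : EuclideanSpace ℝ ι) - x₀'‖) +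
            ρA (ENNReal.ofReal ‖(a : EuclideanSpace ℝ κ) - a'‖))
  bound : ∃ C_r : ℝ, 1 ≤ C_r ∧ ∀ (x₀ x₁ : Ω) (a : A),
    |r x₀ a x₁| ≤
      C_r * (1 + ‖(x₀ : EuclideanSpace ℝ ι)‖ ^ p + ‖(x₁ : EuclideanSpace ℝ ι)‖ ^ p)
  discount_pos : 0 < α
  discount_lt_one : α < 1
  discount_lt : α < 1 / C_P

end Setting

section Wasserstein

variable {ι : Type*} [Fintype ι] {X : Set (EuclideanSpace ℝ ι)}

/-- The `q`-Wasserstein distance on `X ⊆ ℝ^ι` with respect to the Euclidean norm, with values in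
`[0, ∞]`: the infimum is over all joint distributions with marginals `μ` and `ν`. -/
def wasserstein (q : ℕ) (μ ν : Measure X) : ℝ≥0∞ :=
  (⨅ (γ : Measure (X × X)) (_ : γ.map Prod.fst = μ ∧ γ.map Prod.snd = ν),
    ∫⁻ z, ENNReal.ofReal
      (‖(z.1 : EuclideanSpace ℝ ι) - (z.2 : EuclideanSpace ℝ ι)‖ ^ q) ∂γ) ^ (1 / (q : ℝ))

/-- The closed `q`-Wasserstein ball of radius `ε` around `ν`. -/
def wassersteinBall (q : ℕ) (ε : ℝ) (ν : Measure X) : Set (ProbabilityMeasure X) :=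
  {ℙ | wasserstein q (ℙ : Measure X) ν ≤ ENNReal.ofReal ε}

end Wasserstein

section Portfolio

variable {D : ℕ} {Z : Set (EuclideanSpace ℝ (Fin D))}

/-- `Z ^ m` as a subset of the Euclidean space `ℝ^{m D}`: every one of the `m` blocks of length
`D` lies in `Z`. -/
def states (Z : Set (EuclideanSpace ℝ (Fin D))) (m : ℕ) :
    Set (EuclideanSpace ℝ (Fin m × Fin D)) :=
  {x | ∀ i : Fin m, WithLp.toLp 2 (fun j : Fin D => x (i, j)) ∈ Z}

/-- The `i`-th component (counted from `0`) of a state in `Z ^ m`. -/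
def block {m : ℕ} (x : states Z m) (i : Fin m) : Z :=
  ⟨WithLp.toLp 2 (fun j : Fin D => (x : EuclideanSpace ℝ (Fin m × Fin D)) (i, j)), x.2 i⟩

/-- The state in `Z ^ m` with given components. -/
def ofBlocks {m : ℕ} (z : Fin m → Z) : states Z m :=
  ⟨WithLp.toLp 2 (fun ij : Fin m × Fin D => (z ij.1 : EuclideanSpace ℝ (Fin D)) ij.2),
    fun i => (z i).2⟩

/-- The projection `π (x_1, …, x_m) = (x_2, …, x_m)`. -/
def proj {m : ℕ} (x : states Z m) : states Z (m - 1) :=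
  ofBlocks fun i => block x ⟨i + 1, by omega⟩

/-- The identification `Z ^ (m - 1) × Z → Z ^ m` that appends a last component (`m ≥ 1`). -/
def append {m : ℕ} (u : states Z (m - 1) × Z) : states Z m :=
  ofBlocks fun i => if h : (i : ℕ) < m - 1 then block u.1 ⟨i, h⟩ else u.2

/-- The `m` consecutive past returns `(ℛ_{s-m+1}, …, ℛ_s)`, for `s ≥ m`. -/
def window (ℛ : ℕ → Z) (m s : ℕ) : states Z m :=
  ofBlocks fun i => ℛ (s - m + 1 + i)

/-- `dist_s(x) = ‖(ℛ_{s-m+1}, …, ℛ_s) - x‖`, with the Euclidean norm on `ℝ^{m D}`. -/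
def windowDist (ℛ : ℕ → Z) {m : ℕ} (s : ℕ) (x : states Z m) : ℝ :=
  ‖(window ℛ m s : EuclideanSpace ℝ (Fin m × Fin D)) - x‖

/-- The weight `π_s(x) = (dist_s(x) + ε')⁻¹ / ∑_{ℓ=m}^{N-1} (dist_ℓ(x) + ε')⁻¹`. -/
def weight (ℛ : ℕ → Z) (N : ℕ) (ε' : ℝ) {m : ℕ} (s : ℕ) (x : states Z m) : ℝ :=
  (windowDist ℛ s x + ε')⁻¹ / ∑ l ∈ Finset.Icc m (N - 1), (windowDist ℛ l x + ε')⁻¹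

/-- The distance-weighted empirical measure `∑_{s=m}^{N-1} π_s(x) δ_{ℛ_{s+1}}` on `Z`. -/
def empirical (ℛ : ℕ → Z) (N : ℕ) (ε' : ℝ) {m : ℕ} (x : states Z m) : Measure Z :=
  ∑ s ∈ Finset.Icc m (N - 1), ENNReal.ofReal (weight ℛ N ε' s x) • Measure.dirac (ℛ (s + 1))

/-- The set of controls `[-C, C]^D`. -/
def actions (D : ℕ) (C : ℝ) : Set (EuclideanSpace ℝ (Fin D)) :=
  {a | ∀ i, a i ∈ Set.Icc (-C) C}

/-- The ambiguity set `{δ_{π(x)} ⊗ ℙ | ℙ in the q-Wasserstein ball of radius ε around the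
weighted empirical measure at x}`, as probability measures on `Z ^ m`. -/
def ambiguity (ℛ : ℕ → Z) (N m : ℕ) (ε' ε C : ℝ) (q : ℕ) :
    states Z m × actions D C → Set (ProbabilityMeasure (states Z m)) :=
  fun xa => {Q | ∃ ℙ ∈ wassersteinBall q ε (empirical ℛ N ε' xa.1),
    (Q : Measure (states Z m)) =
      ((Measure.dirac (proj xa.1)).prod (ℙ : Measure Z)).map append}

/-- The mean `ER = (1 / N) ∑_{s=1}^N ℛ_s` of the past returns. -/
def sampleMean (ℛ : ℕ → Z) (N : ℕ) : Fin D → ℝ :=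
  fun i => (1 / (N : ℝ)) * ∑ s ∈ Finset.Icc 1 N, (ℛ s : EuclideanSpace ℝ (Fin D)) i

/-- The covariance estimate `(1 / (N - 1)) ∑_{s=1}^N (ℛ_s - ER) (ℛ_s - ER)ᵀ`. -/
def sampleCovariance (ℛ : ℕ → Z) (N : ℕ) : Matrix (Fin D) (Fin D) ℝ :=
  Matrix.of fun i j => (1 / ((N : ℝ) - 1)) * ∑ s ∈ Finset.Icc 1 N,
    ((ℛ s : EuclideanSpace ℝ (Fin D)) i - sampleMean ℛ N i) *
      ((ℛ s : EuclideanSpace ℝ (Fin D)) j - sampleMean ℛ N j)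

/-- The mean-variance reward `r(x₀, a, x₁) = ∑ i, a^i z^i - lam (aᵀ S a)`, where `z` is the last
of the `m` components of `x₁`. -/
def reward {m : ℕ} (hm : 1 ≤ m) {C : ℝ} (lam : ℝ) (S : Matrix (Fin D) (Fin D) ℝ) :
    states Z m → actions D C → states Z m → ℝ :=
  fun _ a x₁ =>
    ∑ i, (a : EuclideanSpace ℝ (Fin D)) i *
        (block x₁ ⟨m - 1, by omega⟩ : EuclideanSpace ℝ (Fin D)) i
      - lam * ∑ i, ∑ j, (a : EuclideanSpace ℝ (Fin D)) i * S i j *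
          (a : EuclideanSpace ℝ (Fin D)) j

end Portfolio

end RobustMDP

end

/-! Since `τ_0` is the weak topology, the probability measures on a compact space are compact; so
are the couplings on `Z × Z`, hence `W_q` is jointly lower semicontinuous. Writing `ν x` for the
weighted empirical measure, `{(x, ℙ) | W_q(ℙ, ν x) ≤ ε}` is therefore closed, which gives
compactness and upper hemicontinuity of its image under `(x, ℙ) ↦ δ_{π(x)} ⊗ ℙ`. Lower
hemicontinuity holds because every `ℙ` in the ball around `ν x₀` extends to a continuous selection
of the balls around `ν x`: the weights of `ν` are continuous, and mass that stays in place is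
transported for free. For `p = 0` all growth conditions are boundedness conditions, and `r` is
bounded and Lipschitz in the bounded action, so `C_P = 1` works. -/

noncomputable section

namespace RobustMDP

open scoped NNReal BoundedContinuousFunction

section WeakTopology

variable {ι : Type*} [Fintype ι] (X : Set (EuclideanSpace ℝ ι))

lemma polyGrowth_zero_eq_range :
    polyGrowth 0 X = Set.range ((⇑) : (X →ᵇ ℝ) → X → ℝ) := by
  ext g
  constructor
  · rintro ⟨hg, M, hM⟩
    refine ⟨.ofNormedAddCommGroup g hg (M * 2) fun x => ?_, rfl⟩
    have hx : |g x| / (1 + 1) ≤ M := hM ⟨x, by simp only [pow_zero]⟩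
    rw [Real.norm_eq_abs]
    linarith
  · rintro ⟨f, rfl⟩
    refine ⟨f.continuous, ‖f‖, ?_⟩
    rintro _ ⟨x, rfl⟩
    exact (div_le_self (abs_nonneg _) (by simp)).trans (f.norm_coe_le_norm x)

lemma tau_zero_eq :
    tau 0 X = (inferInstance : TopologicalSpace (ProbabilityMeasure X)) := by
  unfold tau
  rw [polyGrowth_zero_eq_range, iInf_range]
  refine le_antisymm ?_ (le_iInf fun f =>
    (ProbabilityMeasure.continuous_integral_boundedContinuousFunction f).le_induced)
  rw [← continuous_id_iff_le]
  refine (@ProbabilityMeasure.continuous_iff_forall_continuous_integral X _ _ _ _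
    (_) id).2 fun f => ?_
  exact continuous_iff_le_induced.2 (iInf_le _ f)

end WeakTopology

section Hemicontinuity

variable {X Y K : Type*} [TopologicalSpace X] [TopologicalSpace Y] [TopologicalSpace K]

lemma upperHemicontinuous_image_of_isClosed_graph [CompactSpace K] {F : X → Set K}
    (hF : IsClosed {t : X × K | t.2 ∈ F t.1}) {f : X → K → Y}
    (hf : Continuous fun t : X × K => f t.1 t.2) : UpperHemicontinuous fun x => f x '' F x := by
  rw [upperHemicontinuous_iff_forall_isOpen]
  intro x u hu hxu
  let bad : Set (X × K) := {t | t.2 ∈ F t.1} ∩ (fun t => f t.1 t.2) ⁻¹' uᶜ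
  have hbad : IsClosed (Prod.fst '' bad) :=
    isClosedMap_fst_of_compactSpace _ (hF.inter (hu.isClosed_compl.preimage hf))
  have hx : x ∉ Prod.fst '' bad := by
    rintro ⟨⟨x, k⟩, ⟨hk, hku⟩, rfl⟩
    exact hku (hxu ⟨k, hk, rfl⟩)
  filter_upwards [hbad.isOpen_compl.mem_nhds hx] with x' hx'
  rintro _ ⟨k, hk, rfl⟩
  by_contra hku
  exact hx' ⟨(x', k), ⟨hk, hku⟩, rfl⟩

lemma lowerHemicontinuous_image_of_exists_selection {F : X → Set K}
    (hF : ∀ x, ∀ k ∈ F x, ∃ g : X → K, Continuous g ∧ g x = k ∧ ∀ x', g x' ∈ F x') {f : X → K → Y}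
    (hf : Continuous fun t : X × K => f t.1 t.2) : LowerHemicontinuous fun x => f x '' F x := by
  rintro x u ⟨hu, _, ⟨k, hk, rfl⟩, hku⟩
  obtain ⟨g, hg, rfl, hgF⟩ := hF x k hk
  have hfg : Continuous fun x' => f x' (g x') := hf.comp (continuous_id.prodMk hg)
  filter_upwards [hfg.continuousAt.preimage_mem_nhds (hu.mem_nhds hku)] with x' hx'
  exact ⟨hu, f x' (g x'), ⟨g x', hgF x', rfl⟩, hx'⟩

end Hemicontinuity

section OptimalTransport

variable {X Y : Type*} [MeasurableSpace X] [MeasurableSpace Y]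

/-- The joint distributions (transport plans) with marginals `μ` and `ν`. -/
def couplings (μ : Measure X) (ν : Measure Y) : Set (Measure (X × Y)) :=
  {γ | γ.map Prod.fst = μ ∧ γ.map Prod.snd = ν}

/-- The Kantorovich optimal transport cost for the cost function `c`; it is `∞` if there is no
coupling. -/
def optimalCost (c : X × Y → ℝ≥0∞) (μ : Measure X) (ν : Measure Y) : ℝ≥0∞ :=
  ⨅ γ ∈ couplings μ ν, ∫⁻ z, c z ∂γ

lemma map_diag_mem_couplings (μ : Measure X) : μ.map (fun x => (x, x)) ∈ couplings μ μ := by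
  constructor <;> rw [Measure.map_map (by fun_prop) (by fun_prop)] <;> exact Measure.map_id

lemma add_mem_couplings {μ μ' : Measure X} {ν ν' : Measure Y} {γ γ' : Measure (X × Y)}
    (hγ : γ ∈ couplings μ ν) (hγ' : γ' ∈ couplings μ' ν') :
    γ + γ' ∈ couplings (μ + μ') (ν + ν') := by
  refine ⟨?_, ?_⟩
  · rw [Measure.map_add _ _ measurable_fst, hγ.1, hγ'.1]
  · rw [Measure.map_add _ _ measurable_snd, hγ.2, hγ'.2]

lemma smul_mem_couplings {μ : Measure X} {ν : Measure Y} {γ : Measure (X × Y)} (κ : ℝ≥0)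
    (hγ : γ ∈ couplings μ ν) : κ • γ ∈ couplings (κ • μ) (κ • ν) := by
  refine ⟨?_, ?_⟩
  · rw [Measure.map_smul, hγ.1]
  · rw [Measure.map_smul, hγ.2]

lemma isProbabilityMeasure_of_mem_couplings {μ : Measure X} [hμ : IsProbabilityMeasure μ]
    {ν : Measure Y} {γ : Measure (X × Y)} (hγ : γ ∈ couplings μ ν) : IsProbabilityMeasure γ := by
  have : IsProbabilityMeasure (γ.map Prod.fst) := hγ.1.symm ▸ hμ
  exact Measure.isProbabilityMeasure_of_map Prod.fst

lemma optimalCost_map_fst_map_snd_le (c : X × Y → ℝ≥0∞) (γ : Measure (X × Y)) :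
    optimalCost c (γ.map Prod.fst) (γ.map Prod.snd) ≤ ∫⁻ z, c z ∂γ :=
  iInf₂_le γ ⟨rfl, rfl⟩

lemma optimalCost_self {c : X × X → ℝ≥0∞} (hc : ∀ x, c (x, x) = 0) (μ : Measure X) :
    optimalCost c μ μ = 0 := by
  refine le_antisymm (iInf₂_le_of_le _ (map_diag_mem_couplings μ) ?_) zero_le
  refine (lintegral_map_le _ _).trans_eq ?_
  simp only [hc, lintegral_zero]

lemma optimalCost_smul_add_le {c : X × X → ℝ≥0∞} (hc : ∀ x, c (x, x) = 0) {κ : ℝ≥0}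
    (hκ : κ ≤ 1) (μ ν ρ : Measure X) :
    optimalCost c (κ • μ + ρ) (κ • ν + ρ) ≤ optimalCost c μ ν := by
  refine le_iInf₂ fun γ hγ => iInf₂_le_of_le _
    (add_mem_couplings (smul_mem_couplings κ hγ) (map_diag_mem_couplings ρ)) ?_
  have hdiag : ∫⁻ z, c z ∂ρ.map (fun x => (x, x)) = 0 := by
    refine le_antisymm ((lintegral_map_le _ _).trans_eq ?_) zero_le
    simp only [hc, lintegral_zero]
  rw [lintegral_add_measure, hdiag, add_zero, lintegral_smul_measure]
  exact mul_le_of_le_one_left zero_le (by exact_mod_cast hκ)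

variable [TopologicalSpace X] [CompactSpace X] [T2Space X] [SecondCountableTopology X]
  [BorelSpace X] [TopologicalSpace Y] [CompactSpace Y] [T2Space Y] [SecondCountableTopology Y]
  [BorelSpace Y]

lemma exists_mem_couplings_lintegral_eq_optimalCost (c : C(X × Y, ℝ≥0)) (μ : ProbabilityMeasure X)
    (ν : ProbabilityMeasure Y) :
    ∃ γ : ProbabilityMeasure (X × Y), (γ : Measure (X × Y)) ∈ couplings (μ : Measure X) ν ∧
      ∫⁻ z, c z ∂(γ : Measure (X × Y)) = optimalCost (fun z => c z) μ ν := by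
  let S : Set (ProbabilityMeasure (X × Y)) :=
    {γ | γ.map measurable_fst.aemeasurable = μ ∧ γ.map measurable_snd.aemeasurable = ν}
  have hS : IsCompact S :=
    ((isClosed_eq (ProbabilityMeasure.continuous_map continuous_fst) continuous_const).inter
      (isClosed_eq (ProbabilityMeasure.continuous_map continuous_snd)
        continuous_const)).isCompact
  have hne : S.Nonempty :=
    ⟨μ.prod ν, ProbabilityMeasure.map_fst_prod μ ν, ProbabilityMeasure.map_snd_prod μ ν⟩
  obtain ⟨γ, hγ, hmin⟩ :=
    hS.exists_isMinOn hne (ProbabilityMeasure.continuous_lintegral_continuousMap c).continuousOn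
  have hγ' : (γ : Measure (X × Y)) ∈ couplings (μ : Measure X) ν :=
    ⟨congrArg Subtype.val hγ.1, congrArg Subtype.val hγ.2⟩
  refine ⟨γ, hγ', le_antisymm (le_iInf₂ fun γ' h => ?_) (iInf₂_le _ hγ')⟩
  exact hmin (a := ⟨γ', isProbabilityMeasure_of_mem_couplings h⟩)
    ⟨Subtype.ext h.1, Subtype.ext h.2⟩

lemma lowerSemicontinuous_optimalCost (c : C(X × Y, ℝ≥0)) :
    LowerSemicontinuous fun P : ProbabilityMeasure X × ProbabilityMeasure Y =>
      optimalCost (fun z => c z) (P.1 : Measure X) P.2 := by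
  rw [lowerSemicontinuous_iff_isClosed_preimage]
  intro r
  let marginals (γ : ProbabilityMeasure (X × Y)) : ProbabilityMeasure X × ProbabilityMeasure Y :=
    (γ.map measurable_fst.aemeasurable, γ.map measurable_snd.aemeasurable)
  have hmarginals : Continuous marginals :=
    (ProbabilityMeasure.continuous_map continuous_fst).prodMk
      (ProbabilityMeasure.continuous_map continuous_snd)
  have hcheap : IsClosed
      {γ : ProbabilityMeasure (X × Y) | ∫⁻ z, c z ∂(γ : Measure (X × Y)) ≤ r} :=
    isClosed_le (ProbabilityMeasure.continuous_lintegral_continuousMap c) continuous_const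
  convert (hcheap.isCompact.image hmarginals).isClosed
  ext ⟨μ, ν⟩
  constructor
  · intro h
    obtain ⟨γ, hγ, hcost⟩ := exists_mem_couplings_lintegral_eq_optimalCost c μ ν
    exact ⟨γ, hcost.trans_le h, Prod.ext (Subtype.ext hγ.1) (Subtype.ext hγ.2)⟩
  · rintro ⟨γ, hγ, ⟨⟩⟩
    exact (optimalCost_map_fst_map_snd_le _ _).trans hγ

end OptimalTransport

section WassersteinBall

variable {ι : Type*} [Fintype ι] {Z : Set (EuclideanSpace ℝ ι)}

/-- The cost `‖y - z‖ ^ q` of the `q`-Wasserstein distance, as a continuous function so that it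
can serve as a cost in `lowerSemicontinuous_optimalCost`. -/
def powCost (Z : Set (EuclideanSpace ℝ ι)) (q : ℕ) : C(Z × Z, ℝ≥0) :=
  ⟨fun z => (‖(z.1 : EuclideanSpace ℝ ι) - (z.2 : EuclideanSpace ℝ ι)‖ ^ q).toNNReal,
    by fun_prop⟩

lemma powCost_diag {q : ℕ} (hq : 1 ≤ q) (z : Z) : (powCost Z q (z, z) : ℝ≥0∞) = 0 := by
  simp [powCost, Nat.one_le_iff_ne_zero.1 hq]

lemma wasserstein_eq_optimalCost_rpow (q : ℕ) (μ ν : Measure Z) :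
    wasserstein q μ ν = optimalCost (fun z => powCost Z q z) μ ν ^ (1 / (q : ℝ)) :=
  rfl

lemma wasserstein_self {q : ℕ} (hq : 1 ≤ q) (μ : Measure Z) : wasserstein q μ μ = 0 := by
  rw [wasserstein_eq_optimalCost_rpow, optimalCost_self (powCost_diag hq)]
  exact ENNReal.zero_rpow_of_pos (by positivity)

lemma wasserstein_smul_add_le {q : ℕ} (hq : 1 ≤ q) {κ : ℝ≥0} (hκ : κ ≤ 1) (μ ν ρ : Measure Z) :
    wasserstein q (κ • μ + ρ) (κ • ν + ρ) ≤ wasserstein q μ ν := by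
  simp only [wasserstein_eq_optimalCost_rpow]
  exact ENNReal.rpow_le_rpow (optimalCost_smul_add_le (powCost_diag hq) hκ μ ν ρ) (by positivity)

lemma self_mem_wassersteinBall {q : ℕ} (hq : 1 ≤ q) (ε : ℝ) (ν : ProbabilityMeasure Z) :
    ν ∈ wassersteinBall q ε (ν : Measure Z) :=
  (wasserstein_self hq _).trans_le zero_le

lemma lowerSemicontinuous_wasserstein [CompactSpace Z] (q : ℕ) :
    LowerSemicontinuous fun P : ProbabilityMeasure Z × ProbabilityMeasure Z =>
      wasserstein q (P.1 : Measure Z) P.2 :=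
  ENNReal.continuous_rpow_const.comp_lowerSemicontinuous
    (lowerSemicontinuous_optimalCost (powCost Z q))
    (ENNReal.monotone_rpow_of_nonneg (by positivity))

lemma isClosed_setOf_mem_wassersteinBall [CompactSpace Z] (q : ℕ) (ε : ℝ) :
    IsClosed {P : ProbabilityMeasure Z × ProbabilityMeasure Z |
      P.1 ∈ wassersteinBall q ε (P.2 : Measure Z)} :=
  (lowerSemicontinuous_wasserstein q).isClosed_preimage _

lemma isClosed_wassersteinBall [CompactSpace Z] (q : ℕ) (ε : ℝ) (ν : ProbabilityMeasure Z) :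
    IsClosed (wassersteinBall q ε (ν : Measure Z)) :=
  (isClosed_setOf_mem_wassersteinBall q ε).preimage (Continuous.prodMk_left ν)

end WassersteinBall

section Mixtures

variable {ι X : Type*} [TopologicalSpace X]

lemma exists_continuous_scaling (I : Finset ι) {w : ι → X → ℝ≥0}
    (hw : ∀ s ∈ I, Continuous (w s)) (x₀ : X) :
    ∃ κ : X → ℝ≥0, Continuous κ ∧ κ x₀ = 1 ∧ ∀ x, κ x ≤ 1 ∧ ∀ s ∈ I, κ x * w s x₀ ≤ w s x := by
  classical
  induction I using Finset.induction with
  | empty => exact ⟨1, continuous_one, rfl, fun x => ⟨le_rfl, by simp⟩⟩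
  | insert t I _ ih =>
    obtain ⟨κ, hκ, hκ₀, hκw⟩ := ih fun s hs => hw s (Finset.mem_insert_of_mem hs)
    rcases eq_or_ne (w t x₀) 0 with ht | ht
    · refine ⟨κ, hκ, hκ₀, fun x => ⟨(hκw x).1, Finset.forall_mem_insert .. |>.2 ⟨?_, (hκw x).2⟩⟩⟩
      rw [ht, mul_zero]
      exact zero_le
    · refine ⟨fun x => min (κ x) (w t x / w t x₀),
        hκ.min ((hw t (Finset.mem_insert_self t I)).div_const _), ?_, fun x =>
        ⟨min_le_of_left_le (hκw x).1, Finset.forall_mem_insert .. |>.2 ⟨?_, fun s hs => ?_⟩⟩⟩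
      · simp only [hκ₀, div_self ht, min_self]
      · exact (mul_le_mul_left (min_le_right _ _) _).trans_eq (div_mul_cancel₀ _ ht)
      · exact (mul_le_mul_left (min_le_left _ _) _).trans ((hκw x).2 s hs)

lemma continuous_of_toFiniteMeasure_eq_sum_smul {Z : Type*} [TopologicalSpace Z]
    [MeasurableSpace Z] [OpensMeasurableSpace Z] {I : Finset ι} {w : ι → X → ℝ≥0}
    (hw : ∀ s ∈ I, Continuous (w s)) (μ : ι → FiniteMeasure Z) {ν : X → ProbabilityMeasure Z}
    (hν : ∀ x, (ν x).toFiniteMeasure = ∑ s ∈ I, w s x • μ s) : Continuous ν := by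
  rw [(ProbabilityMeasure.toFiniteMeasure_isEmbedding Z).continuous_iff]
  exact (continuous_finsetSum _ fun s hs => (hw s hs).smul continuous_const).congr fun x =>
    (hν x).symm

variable {J : Type*} [Fintype J] {Z : Set (EuclideanSpace ℝ J)}

-- The element `ℙ` of the ball around `ν x₀` is moved to `κ x • ℙ + ρ x`, where `ρ x` is what
-- `κ x • ν x₀` lacks of `ν x`: transport `κ x • ℙ` as before and leave `ρ x` in place.
lemma exists_continuous_selection_wassersteinBall {q : ℕ} (hq : 1 ≤ q) {ε : ℝ} {I : Finset ι}
    {w : ι → X → ℝ≥0} (hw : ∀ s ∈ I, Continuous (w s)) (μ : ι → FiniteMeasure Z)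
    {ν : X → ProbabilityMeasure Z} (hν : ∀ x, (ν x).toFiniteMeasure = ∑ s ∈ I, w s x • μ s)
    (x₀ : X) {ℙ : ProbabilityMeasure Z} (hℙ : ℙ ∈ wassersteinBall q ε (ν x₀ : Measure Z)) :
    ∃ g : X → ProbabilityMeasure Z, Continuous g ∧ g x₀ = ℙ ∧
      ∀ x, g x ∈ wassersteinBall q ε (ν x : Measure Z) := by
  obtain ⟨κ, hκ, hκ₀, hκw⟩ := exists_continuous_scaling I hw x₀
  let ρ (x : X) : FiniteMeasure Z := ∑ s ∈ I, (w s x - κ x * w s x₀) • μ s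
  have hκρ : ∀ x, κ x • (ν x₀).toFiniteMeasure + ρ x = (ν x).toFiniteMeasure := fun x => by
    simp only [hν, ρ, Finset.smul_sum, ← Finset.sum_add_distrib, smul_smul, ← add_smul]
    exact Finset.sum_congr rfl fun s hs => by rw [add_tsub_cancel_of_le ((hκw x).2 s hs)]
  have hprob : ∀ x, κ x • ℙ.toFiniteMeasure + ρ x ∈
      Set.range (ProbabilityMeasure.toFiniteMeasure (Ω := Z)) := fun x => by
    rw [ProbabilityMeasure.range_toFiniteMeasure, Set.mem_ofPred_eq]
    have hνx := congrArg FiniteMeasure.mass (hκρ x)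
    simp only [FiniteMeasure.mass, FiniteMeasure.coeFn_add, FiniteMeasure.coeFn_smul,
      Pi.add_apply, Pi.smul_apply, ProbabilityMeasure.coeFn_toFiniteMeasure,
      ProbabilityMeasure.coeFn_univ] at hνx ⊢
    exact hνx
  choose g hg using hprob
  refine ⟨g, ?_, ?_, fun x => ?_⟩
  · rw [(ProbabilityMeasure.toFiniteMeasure_isEmbedding Z).continuous_iff]
    have hρ : Continuous ρ := continuous_finsetSum _ fun s hs =>
      ((hw s hs).sub (hκ.mul continuous_const)).smul continuous_const
    exact ((hκ.smul continuous_const).add hρ).congr fun x => (hg x).symm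
  · refine (ProbabilityMeasure.toFiniteMeasure_isEmbedding Z).injective ?_
    simp [hg, ρ, hκ₀]
  · have hgx : (g x : Measure Z) = κ x • (ℙ : Measure Z) + ρ x :=
      congrArg Subtype.val (hg x)
    have hνx : (ν x : Measure Z) = κ x • (ν x₀ : Measure Z) + ρ x :=
      congrArg Subtype.val (hκρ x).symm
    change wasserstein q _ _ ≤ _
    rw [hgx, hνx]
    exact (wasserstein_smul_add_le hq (hκw x).1 _ _ _).trans hℙ

end Mixtures

section Portfolio

variable {D : ℕ} {Z : Set (EuclideanSpace ℝ (Fin D))} {m : ℕ}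

lemma continuous_block (i : Fin m) : Continuous fun x : states Z m => block x i := by
  unfold block
  fun_prop

lemma continuous_ofBlocks : Continuous (ofBlocks : (Fin m → Z) → states Z m) := by
  unfold ofBlocks
  fun_prop

lemma continuous_proj : Continuous (proj : states Z m → states Z (m - 1)) :=
  continuous_ofBlocks.comp (continuous_pi fun _ => continuous_block _)

lemma continuous_append : Continuous (append : states Z (m - 1) × Z → states Z m) := by
  refine continuous_ofBlocks.comp (continuous_pi fun i => ?_)
  split_ifs
  · exact (continuous_block _).comp continuous_fst
  · exact continuous_snd

lemma continuous_windowDist (ℛ : ℕ → Z) (s : ℕ) :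
    Continuous (windowDist ℛ s : states Z m → ℝ) := by
  unfold windowDist
  fun_prop

/-- The law `δ_{π(x)} ⊗ ℙ` of the next state when the next return has law `ℙ`. -/
def nextLaw (x : states Z m) (ℙ : ProbabilityMeasure Z) : ProbabilityMeasure (states Z m) :=
  ((diracProba (proj x)).prod ℙ).map continuous_append.measurable.aemeasurable

lemma continuous_nextLaw {X : Type*} [TopologicalSpace X] {f : X → states Z m}
    {g : X → ProbabilityMeasure Z} (hf : Continuous f) (hg : Continuous g) :
    Continuous fun t => nextLaw (f t) (g t) :=
  (ProbabilityMeasure.continuous_map continuous_append).comp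
    (ProbabilityMeasure.continuous_prod.comp
      ((continuous_diracProba.comp (continuous_proj.comp hf)).prodMk hg))

variable (ℛ : ℕ → Z) {N : ℕ} (hmN : m < N) {ε' : ℝ} (hε' : 0 < ε')

include hε' in
lemma inv_windowDist_add_pos (s : ℕ) (x : states Z m) : 0 < (windowDist ℛ s x + ε')⁻¹ :=
  inv_pos.2 (add_pos_of_nonneg_of_pos (norm_nonneg _) hε')

include hmN hε'

lemma sum_inv_windowDist_add_pos (x : states Z m) :
    0 < ∑ l ∈ Finset.Icc m (N - 1), (windowDist ℛ l x + ε')⁻¹ :=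
  Finset.sum_pos (fun l _ => inv_windowDist_add_pos ℛ hε' l x)
    (Finset.nonempty_Icc.2 (by omega))

lemma weight_nonneg (s : ℕ) (x : states Z m) : 0 ≤ weight ℛ N ε' s x :=
  (div_pos (inv_windowDist_add_pos ℛ hε' s x) (sum_inv_windowDist_add_pos ℛ hmN hε' x)).le

lemma sum_weight (x : states Z m) : ∑ s ∈ Finset.Icc m (N - 1), weight ℛ N ε' s x = 1 := by
  simp only [weight, ← Finset.sum_div]
  exact div_self (sum_inv_windowDist_add_pos ℛ hmN hε' x).ne'

lemma continuous_weight (s : ℕ) : Continuous (weight ℛ N ε' s : states Z m → ℝ) := by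
  have hinv : ∀ l, Continuous fun x : states Z m => (windowDist ℛ l x + ε')⁻¹ := fun l =>
    ((continuous_windowDist ℛ l).add continuous_const).inv₀ fun x =>
      (inv_pos.1 (inv_windowDist_add_pos ℛ hε' l x)).ne'
  exact (hinv s).div (continuous_finsetSum _ fun l _ => hinv l) fun x =>
    (sum_inv_windowDist_add_pos ℛ hmN hε' x).ne'

lemma isProbabilityMeasure_empirical (x : states Z m) :
    IsProbabilityMeasure (empirical ℛ N ε' x) := by
  constructor
  simp only [empirical, Measure.coe_finsetSum, Finset.sum_apply, Measure.smul_apply,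
    measure_univ, smul_eq_mul, mul_one]
  rw [← ENNReal.ofReal_sum_of_nonneg fun s _ => weight_nonneg ℛ hmN hε' s x,
    sum_weight ℛ hmN hε' x, ENNReal.ofReal_one]

/-- The distance-weighted empirical measure as a probability measure. -/
def empiricalProba (x : states Z m) : ProbabilityMeasure Z :=
  ⟨empirical ℛ N ε' x, isProbabilityMeasure_empirical ℛ hmN hε' x⟩

lemma toFiniteMeasure_empiricalProba (x : states Z m) :
    (empiricalProba ℛ hmN hε' x).toFiniteMeasure = ∑ s ∈ Finset.Icc m (N - 1),
      (weight ℛ N ε' s x).toNNReal • (diracProba (ℛ (s + 1))).toFiniteMeasure := by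
  refine FiniteMeasure.toMeasure_injective ?_
  rw [FiniteMeasure.toMeasure_sum]
  rfl

lemma continuous_empiricalProba :
    Continuous (empiricalProba ℛ hmN hε' : states Z m → ProbabilityMeasure Z) :=
  continuous_of_toFiniteMeasure_eq_sum_smul
    (fun s _ => continuous_real_toNNReal.comp (continuous_weight ℛ hmN hε' s)) _
    (toFiniteMeasure_empiricalProba ℛ hmN hε')

variable {q : ℕ} (hq : 1 ≤ q) (ε C : ℝ)

lemma ambiguity_eq_comp_fst (q : ℕ) :
    ambiguity ℛ N m ε' ε C q = (fun x : states Z m =>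
      nextLaw x '' wassersteinBall q ε (empiricalProba ℛ hmN hε' x : Measure Z)) ∘ Prod.fst := by
  ext xa Q
  exact exists_congr fun ℙ => and_congr_right fun _ =>
    ⟨fun h => Subtype.ext h.symm, fun h => congrArg Subtype.val h.symm⟩

lemma isClosed_setOf_mem_wassersteinBall_empiricalProba [CompactSpace Z] (q : ℕ) :
    IsClosed {t : states Z m × ProbabilityMeasure Z |
      t.2 ∈ wassersteinBall q ε (empiricalProba ℛ hmN hε' t.1 : Measure Z)} :=
  (isClosed_setOf_mem_wassersteinBall q ε).preimage
    (continuous_snd.prodMk ((continuous_empiricalProba ℛ hmN hε').comp continuous_fst))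

lemma isCompact_ambiguity [CompactSpace Z] (q : ℕ) (xa : states Z m × actions D C) :
    IsCompact (ambiguity ℛ N m ε' ε C q xa) := by
  rw [ambiguity_eq_comp_fst ℛ hmN hε']
  exact (isClosed_wassersteinBall q ε _).isCompact.image
    (continuous_nextLaw continuous_const continuous_id)

lemma upperHemicontinuous_ambiguity [CompactSpace Z] (q : ℕ) :
    UpperHemicontinuous (ambiguity (D := D) (Z := Z) ℛ N m ε' ε C q) := by
  rw [ambiguity_eq_comp_fst ℛ hmN hε']
  exact (upperHemicontinuous_image_of_isClosed_graph
    (isClosed_setOf_mem_wassersteinBall_empiricalProba ℛ hmN hε' ε q)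
    (continuous_nextLaw continuous_fst continuous_snd)).comp continuous_fst

include hq

lemma nonempty_ambiguity (xa : states Z m × actions D C) :
    (ambiguity ℛ N m ε' ε C q xa).Nonempty := by
  rw [ambiguity_eq_comp_fst ℛ hmN hε']
  exact .image _ ⟨_, self_mem_wassersteinBall hq ε _⟩

lemma lowerHemicontinuous_ambiguity : LowerHemicontinuous (ambiguity ℛ N m ε' ε C q) := by
  rw [ambiguity_eq_comp_fst ℛ hmN hε']
  have hselection (x₀ : states Z m) (ℙ : ProbabilityMeasure Z)
      (hℙ : ℙ ∈ wassersteinBall q ε (empiricalProba ℛ hmN hε' x₀ : Measure Z)) :=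
    exists_continuous_selection_wassersteinBall hq
      (fun s _ => continuous_real_toNNReal.comp (continuous_weight ℛ hmN hε' s)) _
      (toFiniteMeasure_empiricalProba ℛ hmN hε') x₀ hℙ
  exact (lowerHemicontinuous_image_of_exists_selection hselection
    (continuous_nextLaw continuous_fst continuous_snd)).comp continuous_fst

lemma measureAssumption_ambiguity (hZ : IsCompact Z) :
    MeasureAssumption 0 (ambiguity ℛ N m ε' ε C q) 1 := by
  have : CompactSpace Z := isCompact_iff_compactSpace.1 hZ
  refine ⟨Or.inl rfl, nonempty_ambiguity ℛ hmN hε' hq ε C, ?_, ?_, ?_, le_rfl, ?_⟩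
  · rw [tau_zero_eq]
    exact isCompact_ambiguity ℛ hmN hε' ε C q
  · rw [tau_zero_eq]
    exact upperHemicontinuous_ambiguity ℛ hmN hε' ε C q
  · rw [tau_zero_eq]
    exact lowerHemicontinuous_ambiguity ℛ hmN hε' hq ε C
  · intro x a ℙ _
    simp

end Portfolio

section Reward

variable {E : Type*} [NormedAddCommGroup E] [InnerProductSpace ℝ E]

lemma abs_inner_sub_le (T : E →L[ℝ] E) {a z : E} {M R : ℝ} (ha : ‖a‖ ≤ M) (hz : ‖z‖ ≤ R) :
    |inner ℝ a (z - T a)| ≤ (R + M * ‖T‖) * M := by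
  have hM : 0 ≤ M := (norm_nonneg a).trans ha
  have hzT : ‖z - T a‖ ≤ R + ‖T‖ * M := norm_sub_le_of_le hz (T.le_opNorm_of_le ha)
  calc |inner ℝ a (z - T a)| ≤ ‖a‖ * ‖z - T a‖ := abs_real_inner_le_norm _ _
    _ ≤ M * (R + ‖T‖ * M) := by gcongr
    _ = (R + M * ‖T‖) * M := by ring

lemma abs_inner_sub_sub_inner_sub_le (T : E →L[ℝ] E) {a b z : E} {M R : ℝ} (ha : ‖a‖ ≤ M)
    (hb : ‖b‖ ≤ M) (hz : ‖z‖ ≤ R) :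
    |inner ℝ a (z - T a) - inner ℝ b (z - T b)| ≤ (R + 2 * M * ‖T‖) * ‖a - b‖ := by
  have hM : 0 ≤ M := (norm_nonneg a).trans ha
  have hsplit : inner ℝ a (z - T a) - inner ℝ b (z - T b) =
      inner ℝ (a - b) z - (inner ℝ (a - b) (T a) + inner ℝ b (T (a - b))) := by
    simp only [inner_sub_left, inner_sub_right, map_sub]
    ring
  have hz' : |inner ℝ (a - b) z| ≤ ‖a - b‖ * R :=
    (abs_real_inner_le_norm _ _).trans (by gcongr)
  have ha' : |inner ℝ (a - b) (T a)| ≤ ‖a - b‖ * (‖T‖ * M) :=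
    (abs_real_inner_le_norm _ _).trans (by gcongr; exact T.le_opNorm_of_le ha)
  have hb' : |inner ℝ b (T (a - b))| ≤ M * (‖T‖ * ‖a - b‖) :=
    (abs_real_inner_le_norm _ _).trans (by gcongr; exact T.le_opNorm _)
  calc |inner ℝ a (z - T a) - inner ℝ b (z - T b)|
      ≤ ‖a - b‖ * R + (‖a - b‖ * (‖T‖ * M) + M * (‖T‖ * ‖a - b‖)) := by
        rw [hsplit]
        exact (abs_sub _ _).trans (add_le_add hz' ((abs_add_le _ _).trans (add_le_add ha' hb')))
    _ = (R + 2 * M * ‖T‖) * ‖a - b‖ := by ring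

lemma isModulus_zero : IsModulus 0 := ⟨rfl, tendsto_const_nhds⟩

lemma isModulus_id : IsModulus id := ⟨rfl, tendsto_id⟩

lemma rewardAssumption_of_bounded_of_lipschitz {ι κ : Type*} [Fintype ι] [Fintype κ]
    {Ω : Set (EuclideanSpace ℝ ι)} {A : Set (EuclideanSpace ℝ κ)} {r : Ω → A → Ω → ℝ}
    (hr : Continuous fun t : Ω × A × Ω => r t.1 t.2.1 t.2.2) {B L : ℝ}
    (hB : ∀ x₀ a x₁, |r x₀ a x₁| ≤ B)
    (hL : ∀ x₀ x₀' x₁ a a', |r x₀ a x₁ - r x₀' a' x₁| ≤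
      L * ‖(a : EuclideanSpace ℝ κ) - a'‖) (p : ℕ) {C_P α : ℝ}
    (hα₀ : 0 < α) (hα₁ : α < 1) (hα : α < 1 / C_P) :
    RewardAssumption p r C_P α := by
  refine ⟨hr, ⟨max L 1, by positivity, 0, id, isModulus_zero, isModulus_id,
    fun x₀ x₀' x₁ a a' => ?_⟩, ⟨max B 1, le_max_right _ _, fun x₀ x₁ a => ?_⟩, hα₀, hα₁, hα⟩
  · rw [Pi.zero_apply, zero_add, id, ← ENNReal.ofReal_mul (by positivity)]
    refine ENNReal.ofReal_le_ofReal ((hL x₀ x₀' x₁ a a').trans ?_)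
    gcongr
    exact (le_max_left L 1).trans (le_mul_of_one_le_right (by positivity)
      (le_add_of_nonneg_right (by positivity)))
  · refine (hB x₀ a x₁).trans ((le_max_left B 1).trans ?_)
    refine le_mul_of_one_le_right (by positivity) ?_
    rw [add_assoc]
    exact le_add_of_nonneg_right (by positivity)

variable {D m : ℕ} {Z : Set (EuclideanSpace ℝ (Fin D))} {C : ℝ} (hm : 1 ≤ m) (lam : ℝ)
  (S : Matrix (Fin D) (Fin D) ℝ)

lemma continuous_reward : Continuous fun t : states Z m × actions D C × states Z m =>
    reward hm lam S t.1 t.2.1 t.2.2 := by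
  have : Continuous fun t : states Z m × actions D C × states Z m =>
      block t.2.2 ⟨m - 1, by omega⟩ := (continuous_block _).comp (by fun_prop)
  unfold reward
  fun_prop

lemma reward_eq_inner (x₀ x₁ : states Z m) (a : actions D C) :
    reward hm lam S x₀ a x₁ = inner ℝ (a : EuclideanSpace ℝ (Fin D))
      (block x₁ ⟨m - 1, by omega⟩ - (lam • Matrix.toEuclideanCLM (𝕜 := ℝ) S) a) := by
  rw [inner_sub_right, smul_apply, inner_smul_right,
    Matrix.inner_toEuclideanCLM, real_inner_comm]
  simp only [reward, PiLp.inner_apply, dotProduct, Matrix.mulVec, Finset.mul_sum, mul_assoc]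
  rfl

lemma isBounded_actions (D : ℕ) (C : ℝ) : Bornology.IsBounded (actions D C) := by
  have hbox : Bornology.IsBounded (Set.univ.pi fun _ : Fin D => Set.Icc (-C) C) :=
    .pi fun _ => Metric.isBounded_Icc _ _
  refine ((PiLp.antilipschitzWith_ofLp 2 fun _ : Fin D => ℝ).isBounded_preimage hbox).subset ?_
  exact fun a ha i _ => ha i

lemma rewardAssumption_reward (hZ : IsCompact Z) {α : ℝ} (hα₀ : 0 < α) (hα₁ : α < 1) :
    RewardAssumption 0 (reward (Z := Z) (C := C) hm lam S) 1 α := by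
  obtain ⟨R, hR⟩ := hZ.isBounded.exists_norm_le
  obtain ⟨M, hM⟩ := (isBounded_actions D C).exists_norm_le
  let T := lam • Matrix.toEuclideanCLM (𝕜 := ℝ) S
  let L := R + 2 * M * ‖T‖
  have hlip (x₀ x₀' x₁ : states Z m) (a a' : actions D C) :
      |reward hm lam S x₀ a x₁ - reward hm lam S x₀' a' x₁| ≤
        L * ‖(a : EuclideanSpace ℝ (Fin D)) - a'‖ := by
    simp only [reward_eq_inner]
    exact abs_inner_sub_sub_inner_sub_le T (hM a a.2) (hM a' a'.2) (hR _ (block x₁ _).2)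
  have hbound (x₀ : states Z m) (a : actions D C) (x₁ : states Z m) :
      |reward hm lam S x₀ a x₁| ≤ (R + M * ‖T‖) * M := by
    rw [reward_eq_inner]
    exact abs_inner_sub_le T (hM a a.2) (hR _ (block x₁ _).2)
  exact rewardAssumption_of_bounded_of_lipschitz (continuous_reward hm lam S) hbound hlip 0
    hα₀ hα₁ (by rwa [div_one])

end Reward

theorem proposition4p1_general {D : ℕ} {Z : Set (EuclideanSpace ℝ (Fin D))} (hZ : IsCompact Z)
    {m N : ℕ} (hm : 1 ≤ m) (hmN : m < N) (ℛ : ℕ → Z) {q : ℕ} (hq : 1 ≤ q) (ε : ℝ≥0) {ε' : ℝ}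
    (hε' : 0 < ε') (C lam : ℝ) :
    MeasureAssumption 0 (ambiguity ℛ N m ε' ε C q) 1 ∧
      ∀ α : ℝ, 0 < α → α < 1 → ∀ S : Matrix (Fin D) (Fin D) ℝ,
        RewardAssumption 0 (reward (Z := Z) (C := C) hm lam S) 1 α :=
  ⟨measureAssumption_ambiguity ℛ hmN hε' hq ε C hZ,
    fun _ hα₀ hα₁ S => rewardAssumption_reward hm lam S hZ hα₀ hα₁⟩

end RobustMDP

end

open RobustMDP in
/-- `ℛ 1, …, ℛ N` are the past realized returns (other values of `ℛ` play no role). Part one: the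
ambiguity correspondence satisfies the assumption on the set of measures with `p = 0`. Part two:
the reward satisfies the assumption on rewards with `p = 0`, the same constant `C_P` and every
discount factor in `(0, 1)`, for the covariance estimate from the past returns and for every other
covariance (positive semidefinite) matrix. -/
theorem proposition4p1 {D : ℕ} (Z : Set (EuclideanSpace ℝ (Fin D))) (hZ : IsCompact Z)
    (m N : ℕ) (hm : 1 ≤ m) (hmN : m < N) (ℛ : ℕ → Z)
    (q : ℕ) (hq : 1 ≤ q) (ε ε' : ℝ) (hε : 0 < ε) (hε' : 0 < ε')
    (C : ℝ) (hC : 0 < C) (lam : ℝ) (hlam : 0 ≤ lam) :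
    ∃ C_P : ℝ,
      MeasureAssumption 0 (ambiguity ℛ N m ε' ε C q) C_P ∧
      ∀ α : ℝ, 0 < α → α < 1 →
        RewardAssumption 0 (reward (Z := Z) (C := C) hm lam (sampleCovariance ℛ N)) C_P α ∧
        ∀ S : Matrix (Fin D) (Fin D) ℝ, S.PosSemidef →
          RewardAssumption 0 (reward (Z := Z) (C := C) hm lam S) C_P α := by
  obtain ⟨hP, hr⟩ := proposition4p1_general hZ hm hmN ℛ hq ⟨ε, hε.le⟩ hε' C lam
  exact ⟨1, hP, fun α hα₀ hα₁ => ⟨hr α hα₀ hα₁ _, fun S _ => hr α hα₀ hα₁ S⟩⟩
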